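/- Let $n$ be a natural number and let $M_n(\mathbb{R})$ be the space of real $n\times n$ matrices. A principal logarithm of $A\in M_n(\mathbb{R})$ is a matrix $X\in M_n(\mathbb{C})$ with $e^X=A$ all of whose eigenvalues $\lambda\in\mathbb{C}$ satisfy $|\operatorname{Im}\lambda|<\pi$ (such an $X$ is unique if it exists, and it is then real). Let $$K=\{A\in M_n(\mathbb{R}) : A \text{ has a principal logarithm}\}.$$ If $\varphi:M_n(\mathbb{R})\to M_n(\mathbb{R})$ is a bijective linear map with $\varphi(K)=K$, then $\varphi(\mathrm{GL}_n(\mathbb{R}))=\mathrm{GL}_n(\mathbb{R})$. -/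

import Mathlib

/-- `X` is a principal logarithm of the complex matrix `B`: `e ^ X = B`, and every (complex)
eigenvalue `z` of `X` satisfies `|Im z| < π`. -/
def IsPrincipalLog {n : ℕ} (B X : Matrix (Fin n) (Fin n) ℂ) : Prop :=
  NormedSpace.exp X = B ∧ ∀ z ∈ spectrum ℂ X, |z.im| < Real.pi

/-- `K_n`: the real `n × n` matrices (viewed as complex matrices) whose principal logarithm
exists. -/
def principalLogSet (n : ℕ) : Set (Matrix (Fin n) (Fin n) ℝ) :=
  {A | ∃ X : Matrix (Fin n) (Fin n) ℂ, IsPrincipalLog (A.map Complex.ofReal) X}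

/-- `GL_n(ℝ)` as a subset of `M_n(ℝ)`: the invertible matrices. -/
def invertibleMatrices (n : ℕ) : Set (Matrix (Fin n) (Fin n) ℝ) :=
  {A | IsUnit A}

/-! Membership in `K` means having no eigenvalue in `(-∞, 0]`, i.e. `det (A + s) ≠ 0` for all `s ≥
0` (`mem_principalLogSet_iff`). A linear bijection preserving `K` is a homeomorphism, so it
preserves `∂ = closure K \ K`.

Let `D` be diagonal with one zero and ones elsewhere, so `det (D + s) = s (s + 1) ^ (n - 1)`. Near
`D` the nonconstant coefficients of `det (A + s)` stay positive, and there `A ∈ ∂` iff `det A = 0`.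
Suppose such a singular `A` has invertible image. Then `φ A ∈ ∂` has an eigenvalue `-r < 0`, so `φ A
+ t ∈ ∂` for `0 ≤ t ≤ r`. Pulling back, with `E = φ⁻¹ 1`, `A + t E` is singular for small `t > 0`,
hence for all `t` (`det_add_symm_one_eq_zero`).

So `det (φ A) * det (A + E) = 0` for singular `A` near `D`. The singular matrices are parametrized
by `(X, Y) ↦ X D Y`, so by analyticity one factor vanishes on all of them. It is not the second,
because `E ≠ 0`. Thus `φ` maps singular matrices to singular ones, and so does its inverse. -/

open Filter Topology Matrix Polynomial

/-! ### An integral formula for the logarithm in a Banach algebra -/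

section ExpLog

variable {𝔸 : Type*} [NormedRing 𝔸] [NormedAlgebra ℂ 𝔸]

/-- The integrand of the integral representation of the logarithm. -/
noncomputable def logIntegrand (Z : 𝔸) (t : ℝ) : 𝔸 :=
  Z * Ring.inverse (1 + (t : ℂ) • Z)

theorem Commute.logIntegrand_right {b Z : 𝔸} (h : Commute b Z) (t : ℝ) :
    Commute b (logIntegrand Z t) := by
  refine h.mul_right ?_
  have h1 : Commute b (1 + (t : ℂ) • Z) := (Commute.one_right b).add_right (h.smul_right _)
  by_cases hu : IsUnit (1 + (t : ℂ) • Z)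
  · obtain ⟨u, hu⟩ := hu
    rw [← hu] at h1 ⊢
    rw [Ring.inverse_unit]
    exact h1.units_inv_right
  · rw [Ring.inverse_non_unit _ hu]
    exact Commute.zero_right b

variable [CompleteSpace 𝔸]

/-- The exponential along a commuting differentiable path has the usual derivative. -/
theorem HasDerivAt.exp_of_commute {f : ℝ → 𝔸} {f' : 𝔸} {t : ℝ} (hf : HasDerivAt f f' t)
    (hc : ∀ s, Commute (f t) (f s)) :
    HasDerivAt (fun s => NormedSpace.exp (f s)) (NormedSpace.exp (f t) * f') t := by
  let : NormedAlgebra ℚ 𝔸 := NormedAlgebra.restrictScalars ℚ ℂ 𝔸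
  have h1 : HasDerivAt (fun s => NormedSpace.exp (f s - f t)) f' t := by
    have h0 : HasFDerivAt (NormedSpace.exp : 𝔸 → 𝔸) (1 : 𝔸 →L[ℝ] 𝔸) (f t - f t) := by
      rw [sub_self]; exact hasFDerivAt_exp_zero
    exact h0.comp_hasDerivAt t (hf.sub_const (f t))
  refine (h1.const_mul (NormedSpace.exp (f t))).congr_of_eventuallyEq (Eventually.of_forall ?_)
  intro s
  change _ = NormedSpace.exp (f t) * NormedSpace.exp (f s - f t)
  rw [← NormedSpace.exp_add_of_commute ((hc s).sub_right (Commute.refl _))]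
  simp

theorem Commute.intervalIntegral_right {f : ℝ → 𝔸} {b : 𝔸} (hc : ∀ s, Commute b (f s))
    {x y : ℝ} (hf : IntervalIntegrable f MeasureTheory.volume x y) :
    Commute b (∫ s in x..y, f s) := by
  have h1 := (ContinuousLinearMap.mul ℂ 𝔸 b).intervalIntegral_comp_comm hf
  have h2 := ((ContinuousLinearMap.mul ℂ 𝔸).flip b).intervalIntegral_comp_comm hf
  simp only [ContinuousLinearMap.mul_apply', ContinuousLinearMap.flip_apply] at h1 h2
  rw [Commute, SemiconjBy, ← h1, ← h2]
  exact intervalIntegral.integral_congr fun s _ => hc s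

theorem isOpen_setOf_isUnit_one_add_smul (Z : 𝔸) :
    IsOpen {t : ℝ | IsUnit (1 + (t : ℂ) • Z)} := by
  have : Continuous fun t : ℝ => 1 + (t : ℂ) • Z := by fun_prop
  exact Units.isOpen.preimage this

theorem continuousOn_logIntegrand (Z : 𝔸) :
    ContinuousOn (logIntegrand Z) {t : ℝ | IsUnit (1 + (t : ℂ) • Z)} := by
  rintro t ⟨u, hu⟩
  refine ContinuousAt.continuousWithinAt ?_
  have h1 : ContinuousAt (fun t : ℝ => 1 + (t : ℂ) • Z) t := by fun_prop
  have h2 : ContinuousAt (Ring.inverse : 𝔸 → 𝔸) (1 + (t : ℂ) • Z) :=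
    hu ▸ NormedRing.inverse_continuousAt u
  exact continuousAt_const.mul (ContinuousAt.comp (f := fun t : ℝ => 1 + (t : ℂ) • Z) h2 h1)

theorem intervalIntegrable_logIntegrand {Z : 𝔸}
    (hZ : ∀ t ∈ Set.Icc (0 : ℝ) 1, IsUnit (1 + (t : ℂ) • Z)) {t : ℝ}
    (ht : t ∈ Set.Icc (0 : ℝ) 1) :
    IntervalIntegrable (logIntegrand Z) MeasureTheory.volume 0 t := by
  refine ((continuousOn_logIntegrand Z).mono ?_).intervalIntegrable
  rw [Set.uIcc_of_le ht.1]
  exact fun s hs => hZ s ⟨hs.1, hs.2.trans ht.2⟩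

/-- `∫₀¹ Z (1 + t Z)⁻¹ dt` is a logarithm of `1 + Z`. -/
theorem exp_integral_logIntegrand {Z : 𝔸}
    (hZ : ∀ t ∈ Set.Icc (0 : ℝ) 1, IsUnit (1 + (t : ℂ) • Z)) :
    NormedSpace.exp (∫ t in (0 : ℝ)..1, logIntegrand Z t) = 1 + Z := by
  let : NormedAlgebra ℚ 𝔸 := NormedAlgebra.restrictScalars ℚ ℂ 𝔸
  set Y : ℝ → 𝔸 := fun t => ∫ s in (0 : ℝ)..t, logIntegrand Z s with hY
  have hYd : ∀ t ∈ Set.Icc (0 : ℝ) 1, HasDerivAt Y (logIntegrand Z t) t := fun t ht =>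
    intervalIntegral.integral_hasDerivAt_right (intervalIntegrable_logIntegrand hZ ht)
      ((continuousOn_logIntegrand Z).stronglyMeasurableAtFilter
        (isOpen_setOf_isUnit_one_add_smul Z) t (hZ t ht))
      ((continuousOn_logIntegrand Z).continuousAt
        ((isOpen_setOf_isUnit_one_add_smul Z).mem_nhds (hZ t ht)))
  have hcomm : ∀ b : 𝔸, Commute b Z → ∀ t, Commute b (Y t) := by
    intro b hb t
    by_cases hi : IntervalIntegrable (logIntegrand Z) MeasureTheory.volume 0 t
    · exact Commute.intervalIntegral_right (fun s => hb.logIntegrand_right s) hi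
    · rw [hY]; simp only [intervalIntegral.integral_undef hi]; exact Commute.zero_right b
  have hYY : ∀ s t, Commute (Y s) (Y t) := fun s t =>
    hcomm _ ((hcomm Z (Commute.refl Z) s).symm) t
  -- Integrating factor: `Y' (1 + t Z) = Z`, so `exp (-Y) (1 + t Z)` has zero derivative and keeps
  -- its value `1` at `t = 0`.
  set g : ℝ → 𝔸 := fun t => NormedSpace.exp (-Y t) * (1 + (t : ℂ) • Z) with hg
  have hgd : ∀ t ∈ Set.Icc (0 : ℝ) 1, HasDerivAt g 0 t := by
    intro t ht
    have h1 := (hYd t ht).neg.exp_of_commute fun s => ((hYY t s).neg_left).neg_right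
    have h2 : HasDerivAt (fun t : ℝ => 1 + (t : ℂ) • Z) Z t := by
      simpa using ((Complex.ofRealCLM.hasDerivAt (x := t)).smul_const Z).const_add 1
    have h3 := h1.mul h2
    refine h3.congr_deriv ?_
    have h4 : logIntegrand Z t * (1 + (t : ℂ) • Z) = Z := by
      rw [logIntegrand, mul_assoc, Ring.inverse_mul_cancel _ (hZ t ht), mul_one]
    simp only [Pi.neg_apply]
    rw [mul_assoc, neg_mul, h4]
    simp
  have hconst := constant_of_has_deriv_right_zero (f := g) (a := 0) (b := 1)
    (fun t ht => (hgd t ht).continuousAt.continuousWithinAt)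
    (fun t ht => (hgd t ⟨ht.1, ht.2.le⟩).hasDerivWithinAt) 1 (by simp)
  have h0 : g 0 = 1 := by simp [hg, hY, NormedSpace.exp_zero]
  have h1 : NormedSpace.exp (-Y 1) * (1 + Z) = 1 := by
    have h3 : g 1 = 1 := hconst.trans h0
    simpa [hg] using h3
  have h2 : NormedSpace.exp (Y 1) * NormedSpace.exp (-Y 1) = 1 := by
    rw [← NormedSpace.exp_add_of_commute (Commute.neg_right (Commute.refl _))]
    simp [NormedSpace.exp_zero]
  calc NormedSpace.exp (Y 1) = NormedSpace.exp (Y 1) * (NormedSpace.exp (-Y 1) * (1 + Z)) := by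
        rw [h1, mul_one]
    _ = 1 + Z := by rw [← mul_assoc, h2, one_mul]

end ExpLog

/-! ### Principal logarithms and the spectrum -/

section Spectral

attribute [local instance] Matrix.linftyOpNormedRing Matrix.linftyOpNormedAlgebra

variable {n : ℕ}

theorem Matrix.exists_mulVec_eq_smul_of_mem_spectrum {A : Matrix (Fin n) (Fin n) ℂ} {a : ℂ}
    (ha : a ∈ spectrum ℂ A) : ∃ v, v ≠ 0 ∧ A *ᵥ v = a • v := by
  rw [← Matrix.spectrum_toLin'] at ha
  obtain ⟨v, hv⟩ := (Module.End.hasEigenvalue_iff_mem_spectrum.2 ha).exists_hasEigenvector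
  exact ⟨v, hv.2, by simpa using hv.apply_eq_smul⟩

theorem Matrix.mem_spectrum_of_mulVec_eq_smul {A : Matrix (Fin n) (Fin n) ℂ} {a : ℂ}
    {v : Fin n → ℂ} (hv : v ≠ 0) (h : A *ᵥ v = a • v) : a ∈ spectrum ℂ A := by
  rw [← Matrix.spectrum_toLin', ← Module.End.hasEigenvalue_iff_mem_spectrum]
  exact Module.End.hasEigenvalue_of_hasEigenvector
    (Module.End.hasEigenvector_iff.2 ⟨Module.End.mem_eigenspace_iff.2 (by simpa using h), hv⟩)

/-- Commuting complex matrices have a common eigenvector over each eigenvalue of the first. -/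
theorem Matrix.exists_common_eigenvector {A B : Matrix (Fin n) (Fin n) ℂ} (hAB : Commute A B)
    {a : ℂ} (ha : a ∈ spectrum ℂ A) :
    ∃ (b : ℂ) (v : Fin n → ℂ), v ≠ 0 ∧ A *ᵥ v = a • v ∧ B *ᵥ v = b • v := by
  obtain ⟨v, hv, hAv⟩ := exists_mulVec_eq_smul_of_mem_spectrum ha
  set V := Module.End.eigenspace (Matrix.toLin' A) a
  have hmem : ∀ w, w ∈ V ↔ A *ᵥ w = a • w := fun w => by
    simp [V]
  have hB : ∀ w ∈ V, Matrix.toLin' B w ∈ V := by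
    intro w hw
    rw [hmem] at hw ⊢
    rw [Matrix.toLin'_apply, Matrix.mulVec_mulVec, hAB.eq, ← Matrix.mulVec_mulVec, hw,
      Matrix.mulVec_smul]
  have : Nontrivial V := ⟨⟨⟨v, (hmem v).2 hAv⟩, 0, fun h => hv (congrArg Subtype.val h)⟩⟩
  obtain ⟨b, hb⟩ := Module.End.exists_eigenvalue ((Matrix.toLin' B).restrict hB)
  obtain ⟨w, hw⟩ := hb.exists_hasEigenvector
  refine ⟨b, w, fun h => hw.2 (Subtype.ext h), (hmem _).1 w.2, ?_⟩
  have := congrArg Subtype.val hw.apply_eq_smul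
  simpa using this

/-- The continuous linear map `A ↦ A v`. -/
noncomputable def Matrix.mulVecCLM (v : Fin n → ℂ) :
    Matrix (Fin n) (Fin n) ℂ →L[ℂ] (Fin n → ℂ) :=
  LinearMap.toContinuousLinearMap
    { toFun := fun A => A *ᵥ v
      map_add' := fun A B => Matrix.add_mulVec A B v
      map_smul' := fun c A => Matrix.smul_mulVec c A v }

@[simp] theorem Matrix.mulVecCLM_apply (v : Fin n → ℂ) (A : Matrix (Fin n) (Fin n) ℂ) :
    Matrix.mulVecCLM v A = A *ᵥ v := rfl

theorem Matrix.exp_mulVec_of_mulVec_eq_smul {X : Matrix (Fin n) (Fin n) ℂ} {x : ℂ}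
    {v : Fin n → ℂ} (h : X *ᵥ v = x • v) :
    NormedSpace.exp X *ᵥ v = Complex.exp x • v := by
  have hpow : ∀ k : ℕ, X ^ k *ᵥ v = x ^ k • v := by
    intro k
    induction k with
    | zero => simp
    | succ k ih => rw [pow_succ, ← Matrix.mulVec_mulVec, h, Matrix.mulVec_smul, ih, smul_smul,
        pow_succ']
  have h1 := (Matrix.mulVecCLM v).hasSum (NormedSpace.exp_series_hasSum_exp' (𝕂 := ℂ) X)
  have h2 := (NormedSpace.exp_series_hasSum_exp' (𝕂 := ℂ) x).smul_const v
  rw [Complex.exp_eq_exp_ℂ]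
  refine HasSum.unique h1 (h2.congr_fun ?_)
  intro k
  simp [hpow, smul_smul]

/-- The eigenvalues are `(1 - t) + t a` with `a` an eigenvalue of `A`, and the slit plane is
star-shaped about `1`. -/
theorem Matrix.isUnit_one_add_smul_sub_one {A : Matrix (Fin n) (Fin n) ℂ}
    (hA : spectrum ℂ A ⊆ Complex.slitPlane) {t : ℝ} (ht : t ∈ Set.Icc (0 : ℝ) 1) :
    IsUnit (1 + (t : ℂ) • (A - 1)) := by
  by_contra hu
  have h0 : (0 : ℂ) ∈ spectrum ℂ (1 + (t : ℂ) • (A - 1)) := by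
    rwa [spectrum.zero_mem_iff]
  have hc : Commute (1 + (t : ℂ) • (A - 1)) A :=
    (Commute.one_left A).add_left (((Commute.refl A).sub_left (Commute.one_left A)).smul_left _)
  obtain ⟨a, v, hv, h1, h2⟩ := exists_common_eigenvector hc h0
  have ha := hA (mem_spectrum_of_mulVec_eq_smul hv h2)
  have h3 : (1 + (t : ℂ) * (a - 1)) • v = 0 := by
    rw [Matrix.add_mulVec, Matrix.smul_mulVec, Matrix.sub_mulVec, h2, Matrix.one_mulVec,
      zero_smul] at h1
    rw [← h1]; module
  have h4 : 1 + (t : ℂ) * (a - 1) = 0 := (smul_eq_zero.1 h3).resolve_right hv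
  have h5 := Complex.starConvex_one_slitPlane ha (sub_nonneg.2 ht.2) ht.1 (by ring)
  refine Complex.slitPlane_ne_zero h5 ?_
  rw [← h4]
  simp only [Complex.real_smul]
  push_cast
  ring

/-- A complex matrix without eigenvalues in `(-∞, 0]` has a principal logarithm. -/
theorem exists_isPrincipalLog {A : Matrix (Fin n) (Fin n) ℂ}
    (hA : spectrum ℂ A ⊆ Complex.slitPlane) : ∃ X, IsPrincipalLog A X := by
  have hZ : ∀ t ∈ Set.Icc (0 : ℝ) 1, IsUnit (1 + (t : ℂ) • (A - 1)) := fun t ht =>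
    Matrix.isUnit_one_add_smul_sub_one hA ht
  have hint := intervalIntegrable_logIntegrand hZ (t := 1) (by simp)
  refine ⟨∫ t in (0 : ℝ)..1, logIntegrand (A - 1) t, ?_, ?_⟩
  · have := exp_integral_logIntegrand hZ
    rw [add_sub_cancel] at this
    exact this
  · intro z hz
    have hc : Commute (∫ t in (0 : ℝ)..1, logIntegrand (A - 1) t) A :=
      (Commute.intervalIntegral_right (fun s => ((Commute.refl A).sub_right
        (Commute.one_right A)).logIntegrand_right s) hint).symm
    obtain ⟨a, v, hv, h1, h2⟩ := Matrix.exists_common_eigenvector hc hz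
    have ha := hA (Matrix.mem_spectrum_of_mulVec_eq_smul hv h2)
    have hmul : ∀ t : ℝ, (1 + (t : ℂ) • (A - 1)) *ᵥ v = (1 + (t : ℂ) * (a - 1)) • v := by
      intro t
      rw [Matrix.add_mulVec, Matrix.smul_mulVec, Matrix.sub_mulVec, h2, Matrix.one_mulVec]
      module
    have hI : ∀ t ∈ Set.Icc (0 : ℝ) 1,
        logIntegrand (A - 1) t *ᵥ v = ((a - 1) * (1 + t • (a - 1))⁻¹) • v := by
      intro t ht
      have hne : 1 + (t : ℂ) * (a - 1) ≠ 0 := by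
        intro h0
        have h5 := Complex.starConvex_one_slitPlane ha (sub_nonneg.2 ht.2) ht.1 (by ring)
        refine Complex.slitPlane_ne_zero h5 ?_
        rw [← h0]
        simp only [Complex.real_smul]
        push_cast
        ring
      have h6 : Ring.inverse (1 + (t : ℂ) • (A - 1)) *ᵥ v
          = (1 + (t : ℂ) * (a - 1))⁻¹ • v := by
        have h7 := congrArg (fun w => Ring.inverse (1 + (t : ℂ) • (A - 1)) *ᵥ w) (hmul t)
        simp only [Matrix.mulVec_mulVec, Ring.inverse_mul_cancel _ (hZ t ht), Matrix.one_mulVec,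
          Matrix.mulVec_smul] at h7
        rw [h7, smul_smul, inv_mul_cancel₀ hne, one_smul, ← h7]
      rw [logIntegrand, ← Matrix.mulVec_mulVec, h6, Matrix.mulVec_smul, Matrix.sub_mulVec, h2,
        Matrix.one_mulVec, Complex.real_smul]
      module
    have h3 : (∫ t in (0 : ℝ)..1, logIntegrand (A - 1) t) *ᵥ v = Complex.log a • v := by
      have h4 : ∫ t in (0 : ℝ)..1, logIntegrand (A - 1) t *ᵥ v
          = (∫ t in (0 : ℝ)..1, logIntegrand (A - 1) t) *ᵥ v :=
        (Matrix.mulVecCLM v).intervalIntegral_comp_comm hint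
      rw [← h4, intervalIntegral.integral_congr (g := fun t : ℝ =>
          ((a - 1) * (1 + t • (a - 1))⁻¹) • v)
          (fun t ht => hI t (by rwa [Set.uIcc_of_le zero_le_one] at ht)),
        intervalIntegral.integral_smul_const, intervalIntegral.integral_const_mul,
        ← Complex.log_eq_integral (by simpa using ha), add_sub_cancel]
    have hz' : z = Complex.log a := by
      have : (z - Complex.log a) • v = 0 := by rw [sub_smul, ← h1, h3, sub_self]
      exact sub_eq_zero.1 ((smul_eq_zero.1 this).resolve_right hv)
    rw [hz', Complex.log_im, abs_lt]
    exact ⟨Complex.neg_pi_lt_arg a,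
      lt_of_le_of_ne (Complex.arg_le_pi a) (Complex.slitPlane_arg_ne_pi ha)⟩

/-- A complex matrix has a principal logarithm iff it has no eigenvalue in `(-∞, 0]`. -/
theorem exists_isPrincipalLog_iff {A : Matrix (Fin n) (Fin n) ℂ} :
    (∃ X, IsPrincipalLog A X) ↔ spectrum ℂ A ⊆ Complex.slitPlane := by
  refine ⟨?_, exists_isPrincipalLog⟩
  rintro ⟨X, hX, hs⟩ a ha
  have hc : Commute A X := by
    have : Commute (NormedSpace.exp X) X := (Commute.refl X).exp_left
    rwa [hX] at this
  obtain ⟨x, v, hv, h1, h2⟩ := Matrix.exists_common_eigenvector hc ha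
  have h3 := Matrix.exp_mulVec_of_mulVec_eq_smul h2
  rw [hX, h1] at h3
  have h4 : a = Complex.exp x := by
    have : (a - Complex.exp x) • v = 0 := by rw [sub_smul, h3, sub_self]
    exact sub_eq_zero.1 ((smul_eq_zero.1 this).resolve_right hv)
  have hx := abs_lt.1 (hs x (Matrix.mem_spectrum_of_mulVec_eq_smul hv h2))
  rw [h4, Complex.mem_slitPlane_iff_arg]
  refine ⟨?_, Complex.exp_ne_zero x⟩
  rw [← Complex.log_im, Complex.log_exp hx.1 hx.2.le]
  exact hx.2.ne

/-- The real matrices with a principal logarithm are those without eigenvalues in `(-∞, 0]`. -/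
theorem mem_principalLogSet_iff {A : Matrix (Fin n) (Fin n) ℝ} :
    A ∈ principalLogSet n ↔ ∀ s : ℝ, 0 ≤ s → (A + s • 1).det ≠ 0 := by
  have key : ∀ s : ℝ, (A + s • 1).det ≠ 0 ↔ ((-s : ℝ) : ℂ) ∉ spectrum ℂ (A.map Complex.ofReal) := by
    intro s
    have h1 : (((A + s • 1).det : ℝ) : ℂ) = (A.map Complex.ofReal + (s : ℂ) • 1).det := by
      rw [← Complex.ofRealHom_eq_coe, RingHom.map_det]
      congr 1
      ext i j
      by_cases hij : i = j <;> simp [hij]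
    rw [spectrum.notMem_iff, ← Complex.ofReal_ne_zero, h1, Matrix.isUnit_iff_isUnit_det,
      isUnit_iff_ne_zero, Algebra.algebraMap_eq_smul_one]
    have h2 : ((-s : ℝ) : ℂ) • (1 : Matrix (Fin n) (Fin n) ℂ) - A.map Complex.ofReal
        = -(A.map Complex.ofReal + (s : ℂ) • 1) := by
      push_cast
      module
    rw [h2, Matrix.det_neg, mul_ne_zero_iff]
    simp
  rw [principalLogSet, Set.mem_ofPred_eq, exists_isPrincipalLog_iff]
  constructor
  · intro h s hs
    rw [key]
    intro hm
    have := h hm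
    rw [Complex.ofReal_mem_slitPlane] at this
    linarith
  · intro h z hz
    rw [Complex.mem_slitPlane_iff]
    by_contra! hcon
    refine (key (-z.re)).1 (h _ (by linarith [hcon.1])) ?_
    rwa [neg_neg, ← show z = (z.re : ℂ) from Complex.ext (by simp) (by simp [hcon.2])]

end Spectral

/-! ### Parametrizing singular matrices -/

section Singular

variable {n : ℕ}

/-- The diagonal matrix with a zero at `i` and ones elsewhere on the diagonal. -/
def corankOne (i : Fin n) : Matrix (Fin n) (Fin n) ℝ :=
  Matrix.diagonal fun j => if j = i then 0 else 1

theorem det_corankOne (i : Fin n) : (corankOne i).det = 0 := by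
  rw [corankOne, Matrix.det_diagonal]
  exact Finset.prod_eq_zero (Finset.mem_univ i) (by simp)

/-- Every singular matrix factors through a fixed corank one matrix. -/
theorem exists_eq_mul_corankOne_mul (i : Fin n) {A : Matrix (Fin n) (Fin n) ℝ}
    (hA : A.det = 0) : ∃ X Y, A = X * corankOne i * Y := by
  obtain ⟨L, L', d, h⟩ := Matrix.Pivot.exists_list_transvec_mul_diagonal_mul_list_transvec A
  have hd : ∏ j, d j = 0 := by
    rw [h] at hA
    simpa [Matrix.det_mul] using hA
  obtain ⟨j, -, hj⟩ := Finset.prod_eq_zero_iff.1 hd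
  -- Transposing `i` and `j` moves the zero pivot `d j` to the prescribed position.
  set e := Equiv.swap i j
  have h1 : corankOne i = (corankOne j).submatrix e e := by
    rw [corankOne, corankOne, Matrix.submatrix_diagonal_equiv]
    congr 1
    ext k
    have : e k = j ↔ k = i := by
      rw [← Equiv.swap_apply_left i j]; exact e.injective.eq_iff
    simp [this]
  have h2 : Matrix.diagonal d * corankOne j = Matrix.diagonal d := by
    rw [corankOne, Matrix.diagonal_mul_diagonal]
    congr 1
    ext k
    by_cases hk : k = j <;> simp [hk, hj]
  have h3 : (Matrix.diagonal d).submatrix id e * corankOne i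
      * (1 : Matrix (Fin n) (Fin n) ℝ).submatrix e id = Matrix.diagonal d := by
    rw [h1, Matrix.submatrix_mul_equiv, Matrix.submatrix_mul_equiv, h2, mul_one,
      Matrix.submatrix_id_id]
  refine ⟨(L.map Matrix.TransvectionStruct.toMatrix).prod * (Matrix.diagonal d).submatrix id e,
    (1 : Matrix (Fin n) (Fin n) ℝ).submatrix e id
      * (L'.map Matrix.TransvectionStruct.toMatrix).prod, ?_⟩
  rw [h]
  nth_rewrite 1 [← h3]
  simp only [mul_assoc]

/-- No nonzero matrix translates the singular matrices into the singular matrices. -/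
theorem exists_det_eq_zero_det_add_ne_zero {E : Matrix (Fin n) (Fin n) ℝ} (hE : E ≠ 0) :
    ∃ C : Matrix (Fin n) (Fin n) ℝ, C.det = 0 ∧ (C + E).det ≠ 0 := by
  obtain ⟨L, L', d, h⟩ := Matrix.Pivot.exists_list_transvec_mul_diagonal_mul_list_transvec E
  obtain ⟨j, hj⟩ : ∃ j, d j ≠ 0 := by
    by_contra! hd
    refine hE ?_
    rw [h, show d = 0 from funext hd]
    simp
  -- Chosen so that adding `diagonal d` leaves `d j ≠ 0` at `j` and `1` elsewhere.
  refine ⟨(L.map Matrix.TransvectionStruct.toMatrix).prod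
    * Matrix.diagonal (fun k => if k = j then 0 else 1 - d k)
    * (L'.map Matrix.TransvectionStruct.toMatrix).prod, ?_, ?_⟩
  · rw [Matrix.det_mul, Matrix.det_mul, Matrix.det_diagonal,
      Finset.prod_eq_zero (Finset.mem_univ j) (by simp)]
    simp
  · rw [h, ← add_mul, ← mul_add, Matrix.diagonal_add, Matrix.det_mul, Matrix.det_mul,
      Matrix.det_diagonal]
    simp only [Matrix.TransvectionStruct.det_toMatrix_prod, one_mul, mul_one]
    refine Finset.prod_ne_zero_iff.2 fun k _ => ?_
    by_cases hk : k = j <;> simp [hk, hj]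

end Singular

/-! ### The boundary set `closure K \ K` -/

section Boundary

variable {n : ℕ}

theorem det_add_smul_one_eq_eval (A : Matrix (Fin n) (Fin n) ℝ) (s : ℝ) :
    (A + s • 1).det = (-A).charpoly.eval s := by
  rw [Matrix.eval_charpoly, sub_neg_eq_add, add_comm, Matrix.scalar_apply,
    ← Matrix.smul_one_eq_diagonal]

/-- A monic polynomial of positive degree with no root in `[0, ∞)` is positive there. -/
theorem det_add_smul_one_pos (i : Fin n) {A : Matrix (Fin n) (Fin n) ℝ}
    (hA : A ∈ principalLogSet n) {s : ℝ} (hs : 0 ≤ s) : 0 < (A + s • 1).det := by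
  rw [mem_principalLogSet_iff] at hA
  simp only [det_add_smul_one_eq_eval] at hA ⊢
  by_contra! hneg
  have hlim : Tendsto (fun x => (-A).charpoly.eval x) atTop atTop := by
    refine Polynomial.tendsto_atTop_of_leadingCoeff_nonneg _ ?_ ?_
    · rw [Matrix.charpoly_degree_eq_dim, Fintype.card_fin]
      exact_mod_cast i.pos
    · rw [(Matrix.charpoly_monic _).leadingCoeff]; exact zero_le_one
  obtain ⟨r, hr0, hrs⟩ := ((hlim.eventually_gt_atTop 0).and (eventually_ge_atTop s)).exists
  obtain ⟨x, hx, hx0⟩ := intermediate_value_Icc hrs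
    ((-A).charpoly.continuous.continuousOn) ⟨hneg, hr0.le⟩
  exact hA x (hs.trans hx.1) hx0

theorem det_add_smul_one_nonneg_of_mem_closure (i : Fin n) {A : Matrix (Fin n) (Fin n) ℝ}
    (hA : A ∈ closure (principalLogSet n)) {s : ℝ} (hs : 0 ≤ s) : 0 ≤ (A + s • 1).det := by
  have hc : IsClosed {B : Matrix (Fin n) (Fin n) ℝ | 0 ≤ (B + s • 1).det} :=
    isClosed_le continuous_const (by fun_prop)
  exact closure_minimal (fun B hB => (det_add_smul_one_pos i hB hs).le) hc hA

theorem add_smul_one_mem_principalLogSet {A : Matrix (Fin n) (Fin n) ℝ}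
    (hA : A ∈ principalLogSet n) {t : ℝ} (ht : 0 ≤ t) : A + t • 1 ∈ principalLogSet n := by
  rw [mem_principalLogSet_iff] at hA ⊢
  intro s hs
  rw [add_assoc, ← add_smul]
  exact hA _ (add_nonneg ht hs)

theorem add_smul_one_mem_closure_principalLogSet {A : Matrix (Fin n) (Fin n) ℝ}
    (hA : A ∈ closure (principalLogSet n)) {t : ℝ} (ht : 0 ≤ t) :
    A + t • 1 ∈ closure (principalLogSet n) :=
  map_mem_closure (f := fun B : Matrix (Fin n) (Fin n) ℝ => B + t • 1) (by fun_prop) hA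
    fun _ hB => add_smul_one_mem_principalLogSet hB ht

/-- The nonconstant coefficients of `det (A + s)`, as a polynomial in `s`, are positive. -/
def HasPosCoeffs (A : Matrix (Fin n) (Fin n) ℝ) : Prop :=
  ∀ k : Fin n, 0 < (-A).charpoly.coeff (k + 1)

theorem continuous_charpoly_neg_coeff (k : ℕ) :
    Continuous fun A : Matrix (Fin n) (Fin n) ℝ => (-A).charpoly.coeff k := by
  have h : ∀ A : Matrix (Fin n) (Fin n) ℝ, (-A).charpoly.coeff k
      = MvPolynomial.eval (fun ij : Fin n × Fin n => -A ij.1 ij.2)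
        ((Matrix.charpoly.univ ℝ (Fin n)).coeff k) := by
    intro A
    exact (Matrix.charpoly.univ_coeff_eval₂Hom (Fin n) (RingHom.id ℝ)
      (fun ij : Fin n × Fin n => -A ij.1 ij.2) k).symm
  simp only [h]
  exact (MvPolynomial.continuous_eval _).comp
    (continuous_pi fun ij => (continuous_id.matrix_elem ij.1 ij.2).neg)

theorem isOpen_setOf_hasPosCoeffs : IsOpen {A : Matrix (Fin n) (Fin n) ℝ | HasPosCoeffs A} := by
  have : {A : Matrix (Fin n) (Fin n) ℝ | HasPosCoeffs A}
      = ⋂ k : Fin n, {A | 0 < (-A).charpoly.coeff (k + 1)} := by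
    ext A; simp [HasPosCoeffs]
  rw [this]
  exact isOpen_iInter_of_finite fun k =>
    isOpen_lt continuous_const (continuous_charpoly_neg_coeff _)

theorem hasPosCoeffs_corankOne (i : Fin n) : HasPosCoeffs (corankOne i) := by
  intro k
  have h : (-corankOne i).charpoly = X * (X + 1) ^ (n - 1) := by
    rw [corankOne, Matrix.diagonal_neg, Matrix.charpoly_diagonal,
      ← Finset.mul_prod_erase _ _ (Finset.mem_univ i)]
    congr 1
    · simp
    · rw [Finset.prod_congr rfl (g := fun _ => (X + 1 : ℝ[X]))]
      · simp
      · intro j hj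
        simp [Finset.ne_of_mem_erase hj]
  rw [h, Polynomial.coeff_X_mul, Polynomial.coeff_X_add_one_pow]
  exact_mod_cast Nat.choose_pos (by omega)

theorem HasPosCoeffs.det_lt (i : Fin n) {A : Matrix (Fin n) (Fin n) ℝ} (hA : HasPosCoeffs A)
    {s : ℝ} (hs : 0 < s) : A.det < (A + s • 1).det := by
  have h0 : A.det = (A + (0 : ℝ) • 1).det := by simp
  rw [h0, det_add_smul_one_eq_eval, det_add_smul_one_eq_eval, Polynomial.eval_eq_sum_range,
    Polynomial.eval_eq_sum_range, Matrix.charpoly_natDegree_eq_dim, Fintype.card_fin,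
    Finset.sum_range_succ', Finset.sum_range_succ']
  have : 0 < ∑ k ∈ Finset.range n, (-A).charpoly.coeff (k + 1) * s ^ (k + 1) :=
    Finset.sum_pos (fun k hk => mul_pos (hA ⟨k, Finset.mem_range.1 hk⟩) (pow_pos hs _))
      ⟨0, Finset.mem_range.2 i.pos⟩
  simpa using this

theorem HasPosCoeffs.mem_closure_diff (i : Fin n) {A : Matrix (Fin n) (Fin n) ℝ}
    (hA : HasPosCoeffs A) (hdet : A.det = 0) :
    A ∈ closure (principalLogSet n) \ principalLogSet n := by
  refine ⟨?_, fun h => (mem_principalLogSet_iff.1 h) 0 le_rfl (by simpa using hdet)⟩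
  have hlim : Tendsto (fun t : ℝ => A + t • (1 : Matrix (Fin n) (Fin n) ℝ)) (𝓝[>] 0) (𝓝 A) := by
    have : Continuous fun t : ℝ => A + t • (1 : Matrix (Fin n) (Fin n) ℝ) := by fun_prop
    simpa using (this.tendsto 0).mono_left nhdsWithin_le_nhds
  refine mem_closure_of_tendsto hlim ?_
  filter_upwards [self_mem_nhdsWithin] with t ht
  rw [mem_principalLogSet_iff]
  intro s hs
  rw [add_assoc, ← add_smul]
  have := hA.det_lt i (add_pos_of_pos_of_nonneg ht hs)
  rw [hdet] at this
  exact this.ne'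

/-- On the closure `det A ≥ 0`, and `det (A + s)` exceeds `det A` for `s > 0`, so its root can only
be `s = 0`. -/
theorem HasPosCoeffs.det_eq_zero (i : Fin n) {A : Matrix (Fin n) (Fin n) ℝ}
    (hA : HasPosCoeffs A) (h : A ∈ closure (principalLogSet n) \ principalLogSet n) :
    A.det = 0 := by
  have h2 := h.2
  rw [mem_principalLogSet_iff] at h2
  push Not at h2
  obtain ⟨s, hs, hdet⟩ := h2
  have h0 : 0 ≤ A.det := by
    simpa using det_add_smul_one_nonneg_of_mem_closure i h.1 le_rfl
  rcases hs.eq_or_lt with rfl | hs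
  · simpa using hdet
  · have := hA.det_lt i hs
    linarith

/-- Here `-r` is a negative eigenvalue of `B`; the shift by `t ≤ r` moves it to `t - r ≤ 0`, still
an obstruction to lying in `K`. -/
theorem exists_add_smul_one_mem_closure_diff {B : Matrix (Fin n) (Fin n) ℝ}
    (hB : B ∈ closure (principalLogSet n) \ principalLogSet n) (hdet : B.det ≠ 0) :
    ∃ r > 0, ∀ t ∈ Set.Icc (0 : ℝ) r,
      B + t • 1 ∈ closure (principalLogSet n) \ principalLogSet n := by
  have h2 := hB.2
  rw [mem_principalLogSet_iff] at h2
  push Not at h2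
  obtain ⟨r, hr, hr0⟩ := h2
  refine ⟨r, hr.lt_of_ne fun h => hdet (by simpa [← h] using hr0), fun t ht =>
    ⟨add_smul_one_mem_closure_principalLogSet hB.1 ht.1, fun hm => ?_⟩⟩
  refine mem_principalLogSet_iff.1 hm (r - t) (sub_nonneg.2 ht.2) ?_
  rw [add_assoc, ← add_smul, add_sub_cancel]
  exact hr0

end Boundary

/-! ### Linear preservers and analytic continuation -/

section Preserver

variable {n : ℕ}

theorem AnalyticOnNhd.eq_zero_or_eq_zero_of_eventually_mul_eq_zero {E : Type*}
    [NormedAddCommGroup E] [NormedSpace ℝ E] {f g : E → ℝ} (hf : AnalyticOnNhd ℝ f Set.univ)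
    (hg : AnalyticOnNhd ℝ g Set.univ) {x : E} (h : ∀ᶠ y in 𝓝 x, f y * g y = 0) :
    (∀ y, f y = 0) ∨ ∀ y, g y = 0 := by
  by_cases hfx : ∀ᶠ y in 𝓝 x, f y = 0
  · left
    intro y
    exact hf.eqOn_zero_of_preconnected_of_eventuallyEq_zero isPreconnected_univ
      (Set.mem_univ x) hfx (Set.mem_univ y)
  · right
    obtain ⟨y, hy, hy'⟩ := ((not_eventually.1 hfx).and_eventually
      (eventually_eventually_nhds.2 h)).exists
    have hev : g =ᶠ[𝓝 y] 0 := by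
      filter_upwards [hy', (hf y (Set.mem_univ y)).continuousAt.eventually_ne hy] with z hz hz'
      exact (mul_eq_zero.1 hz).resolve_left hz'
    intro z
    exact hg.eqOn_zero_of_preconnected_of_eventuallyEq_zero isPreconnected_univ
      (Set.mem_univ y) hev (Set.mem_univ z)

attribute [local instance] Matrix.linftyOpNormedRing Matrix.linftyOpNormedAlgebra

theorem analyticOnNhd_det :
    AnalyticOnNhd ℝ (fun A : Matrix (Fin n) (Fin n) ℝ => A.det) Set.univ := by
  intro A _
  simp only [Matrix.det_apply']
  refine Finset.analyticAt_fun_sum _ fun σ _ => analyticAt_const.mul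
    (Finset.analyticAt_fun_prod _ fun i _ => ?_)
  exact ((Matrix.entryLinearMap ℝ ℝ (σ i) i).toContinuousLinearMap).analyticAt A

theorem det_add_symm_one_eq_zero (i : Fin n)
    (φ : Matrix (Fin n) (Fin n) ℝ ≃ₗ[ℝ] Matrix (Fin n) (Fin n) ℝ)
    (hK : ∀ A, φ A ∈ closure (principalLogSet n) \ principalLogSet n ↔
      A ∈ closure (principalLogSet n) \ principalLogSet n)
    {A : Matrix (Fin n) (Fin n) ℝ} (hA : HasPosCoeffs A) (hdet : A.det = 0)
    (hφ : (φ A).det ≠ 0) : (A + φ.symm 1).det = 0 := by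
  obtain ⟨r, hr, hmem⟩ := exists_add_smul_one_mem_closure_diff
    ((hK A).2 (hA.mem_closure_diff i hdet)) hφ
  have hcont : Continuous fun t : ℝ => A + t • φ.symm 1 := by fun_prop
  have hev : ∀ᶠ t in 𝓝 (0 : ℝ), HasPosCoeffs (A + t • φ.symm 1) :=
    (hcont.tendsto 0).eventually (isOpen_setOf_hasPosCoeffs.mem_nhds (by simpa using hA))
  obtain ⟨ε, hε, hball⟩ := Metric.eventually_nhds_iff.1 hev
  set δ := min r ε with hδ
  have hδ0 : 0 < δ := lt_min hr hε
  -- Centred at `δ / 2`, since boundary membership is known only for `t ≥ 0` and the identity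
  -- theorem needs a full neighbourhood.
  have hzero : ∀ᶠ t in 𝓝 (δ / 2), (A + t • φ.symm 1).det = 0 := by
    filter_upwards [Ioo_mem_nhds (half_pos hδ0) (half_lt_self hδ0)] with t ht
    refine (hball ?_).det_eq_zero i ((hK _).1 ?_)
    · rw [Real.dist_0_eq_abs, abs_of_pos ht.1]
      exact ht.2.trans_le (min_le_right _ _)
    · rw [map_add, map_smul, LinearEquiv.apply_symm_apply]
      exact hmem t ⟨ht.1.le, ht.2.le.trans (min_le_left _ _)⟩
  have han : AnalyticOnNhd ℝ (fun t : ℝ => (A + t • φ.symm 1).det) Set.univ := by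
    intro t _
    refine AnalyticAt.fun_comp (g := fun A : Matrix (Fin n) (Fin n) ℝ => A.det)
      (analyticOnNhd_det _ (Set.mem_univ _)) ?_
    exact analyticAt_const.add (analyticAt_id.smul analyticAt_const)
  have := han.eqOn_zero_of_preconnected_of_eventuallyEq_zero isPreconnected_univ
    (Set.mem_univ (δ / 2)) hzero (Set.mem_univ 1)
  simpa using this

theorem det_map_eq_zero (φ : Matrix (Fin n) (Fin n) ℝ ≃ₗ[ℝ] Matrix (Fin n) (Fin n) ℝ)
    (hK : ∀ A, φ A ∈ principalLogSet n ↔ A ∈ principalLogSet n)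
    {A : Matrix (Fin n) (Fin n) ℝ} (hA : A.det = 0) : (φ A).det = 0 := by
  -- For `n = 0` the determinant is `1`, contradicting `hA`.
  obtain ⟨i⟩ : Nonempty (Fin n) := by
    by_contra hne
    rw [not_nonempty_iff] at hne
    simp at hA
  have hcl : ∀ A, φ A ∈ closure (principalLogSet n) ↔ A ∈ closure (principalLogSet n) := by
    intro A
    have h1 := φ.toContinuousLinearEquiv.toHomeomorph.preimage_closure (principalLogSet n)
    have h2 : φ.toContinuousLinearEquiv.toHomeomorph ⁻¹' principalLogSet n = principalLogSet n :=
      Set.ext hK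
    rw [h2] at h1
    exact Set.ext_iff.1 h1 A
  have hK' : ∀ A, φ A ∈ closure (principalLogSet n) \ principalLogSet n ↔
      A ∈ closure (principalLogSet n) \ principalLogSet n := fun A => by
    rw [Set.mem_sdiff, Set.mem_sdiff, hcl, hK]
  let F := fun p : Matrix (Fin n) (Fin n) ℝ × Matrix (Fin n) (Fin n) ℝ =>
    p.1 * corankOne i * p.2
  have hF : AnalyticOnNhd ℝ F Set.univ := fun p _ =>
    (analyticAt_fst.mul analyticAt_const).mul analyticAt_snd
  have hFdet : ∀ p, (F p).det = 0 := fun p => by simp [F, Matrix.det_mul, det_corankOne]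
  have hg : AnalyticOnNhd ℝ (fun p => (φ (F p)).det) Set.univ := by
    intro p _
    refine AnalyticAt.fun_comp (g := fun A : Matrix (Fin n) (Fin n) ℝ => A.det)
      (analyticOnNhd_det _ (Set.mem_univ _)) ?_
    exact AnalyticAt.fun_comp (φ.toContinuousLinearEquiv.toContinuousLinearMap.analyticAt _)
      (hF p (Set.mem_univ p))
  have hh : AnalyticOnNhd ℝ (fun p => (F p + φ.symm 1).det) Set.univ := by
    intro p _
    exact AnalyticAt.fun_comp (g := fun A : Matrix (Fin n) (Fin n) ℝ => A.det)
      (analyticOnNhd_det _ (Set.mem_univ _)) ((hF p (Set.mem_univ p)).add analyticAt_const)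
  have hev : ∀ᶠ p in 𝓝 ((1, 1) : Matrix (Fin n) (Fin n) ℝ × Matrix (Fin n) (Fin n) ℝ),
      (φ (F p)).det * (F p + φ.symm 1).det = 0 := by
    have h1 : ∀ᶠ p in 𝓝 ((1, 1) : Matrix (Fin n) (Fin n) ℝ × Matrix (Fin n) (Fin n) ℝ),
        HasPosCoeffs (F p) :=
      (hF (1, 1) (Set.mem_univ _)).continuousAt.eventually
        (isOpen_setOf_hasPosCoeffs.mem_nhds (by simpa [F] using hasPosCoeffs_corankOne i))
    filter_upwards [h1] with p hp
    rw [mul_eq_zero, or_iff_not_imp_left]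
    exact det_add_symm_one_eq_zero i φ hK' hp (hFdet p)
  rcases hg.eq_zero_or_eq_zero_of_eventually_mul_eq_zero hh hev with h | h
  · obtain ⟨X, Y, rfl⟩ := exists_eq_mul_corankOne_mul i hA
    exact h (X, Y)
  · exfalso
    have hE : φ.symm 1 ≠ 0 := by
      rw [Ne, LinearEquiv.map_eq_zero_iff]
      have : Nonempty (Fin n) := ⟨i⟩
      exact one_ne_zero
    obtain ⟨C, hC, hCE⟩ := exists_det_eq_zero_det_add_ne_zero hE
    obtain ⟨X, Y, rfl⟩ := exists_eq_mul_corankOne_mul i hC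
    exact hCE (h (X, Y))

end Preserver

theorem mainTheorem5 (n : ℕ)
    (φ : Matrix (Fin n) (Fin n) ℝ →ₗ[ℝ] Matrix (Fin n) (Fin n) ℝ)
    (hφ : Function.Bijective φ)
    (hK : φ '' principalLogSet n = principalLogSet n) :
    φ '' invertibleMatrices n = invertibleMatrices n := by
  let ψ := LinearEquiv.ofBijective φ hφ
  have hψ : ∀ A, ψ A ∈ principalLogSet n ↔ A ∈ principalLogSet n := by
    intro A
    change φ A ∈ principalLogSet n ↔ _
    nth_rewrite 1 [← hK]
    exact hφ.1.mem_set_image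
  have hψ' : ∀ A, ψ.symm A ∈ principalLogSet n ↔ A ∈ principalLogSet n := fun A => by
    rw [← hψ, LinearEquiv.apply_symm_apply]
  have hdet : ∀ A, (φ A).det = 0 ↔ A.det = 0 := fun A =>
    ⟨fun h => by simpa using det_map_eq_zero ψ.symm hψ' (A := ψ A) h,
      fun h => det_map_eq_zero ψ hψ h⟩
  have hinv : ∀ A, φ A ∈ invertibleMatrices n ↔ A ∈ invertibleMatrices n := fun A => by
    rw [invertibleMatrices, Set.mem_ofPred_eq, Set.mem_ofPred_eq, Matrix.isUnit_iff_isUnit_det,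
      Matrix.isUnit_iff_isUnit_det, isUnit_iff_ne_zero, isUnit_iff_ne_zero, Ne, hdet]
  ext B
  constructor
  · rintro ⟨A, hA, rfl⟩
    exact (hinv A).2 hA
  · intro hB
    obtain ⟨A, rfl⟩ := hφ.2 B
    exact ⟨A, (hinv A).1 hB, rfl⟩
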